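/- Let $q$ be a prime power, $m\ge 3$ an integer and $a$ a positive divisor of $m$ with $a<m$. Put $n=q^m$ and $r=q^{m-a}-1$. Then there exists a strongly regular Cayley graph $\mathrm{Cay}(A,D)$ on a finite abelian group $A$ with parameters $$(v,k,\lambda,\mu)=\bigl(n^2,\ r(n+1),\ -n+r^2+3r,\ r^2+r\bigr).$$ (Here $D\subseteq A$ satisfies $0\notin D$ and $-D=D$, two vertices $x,y\in A$ are adjacent iff $x-y\in D$, and strongly regular graphs are by definition neither edgeless nor complete.) More precisely, the following lift of the subfield cyclotomic strongly regular graph $\mathrm{Cay}(\mathbb F_{q^m},\mathbb F_{q^a}^*)$ is such a graph. Let $C_0=\mathbb F_{q^a}^*\le\mathbb F_{q^m}^*$, let $e=[\mathbb F_{q^m}^*:C_0]=\frac{q^m-1}{q^a-1}$ and $\overline{C_0}=C_0/\mathbb F_q^*$, let $$H_0=\{\,x\mathbb F_q^* : x\in\mathbb F_{q^m}^*,\ \mathrm{Tr}_{q^m/q}(x)=0\,\}\subseteq \mathbb F_{q^m}^*/\mathbb F_q^*$$ be the Singer difference set, and let $S'$ be the set of all $s\in\mathbb F_{q^m}^*/\mathbb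 F_q^*$ for which $|H_0\cap s\overline{C_0}|$ is maximal. Let $\gamma$ be any primitive element of $\mathbb F_{q^{2m}}$, let $\omega=\mathrm{N}_{q^{2m}/q^m}(\gamma)$, and let $$I=\{\,0\le i\le e-1 : \omega^i\mathbb F_q^*\in S'\,\},\qquad D=\bigcup_{i\in I}\gamma^i\langle\gamma^e\rangle\subseteq\mathbb F_{q^{2m}}.$$ Then $\mathrm{Cay}(\mathbb F_{q^{2m}},D)$ is a strongly regular Cayley graph with the above parameters. -/

import Mathlib

open scoped Pointwise

/-- `G` is a strongly regular graph with parameters `(v, k, l, μ)`, written as integers so that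
formulas with subtraction have their usual meaning. As is customary, edgeless and complete graphs
are not counted as strongly regular. -/
structure IsStronglyRegular {V : Type*} [Fintype V] (G : SimpleGraph V) (v k l μ : ℤ) : Prop where
  ne_bot : G ≠ ⊥
  ne_top : G ≠ ⊤
  exists_nat : open Classical in ∃ v' k' l' μ' : ℕ,
    (v' : ℤ) = v ∧ (k' : ℤ) = k ∧ (l' : ℤ) = l ∧ (μ' : ℤ) = μ ∧ G.IsSRGWith v' k' l' μ'

/-- `Cay(A, D)` is a strongly regular Cayley graph with parameters `(v, k, l, μ)`: the connection
set `D` satisfies `0 ∉ D` and `-D = D`, and the graph with vertex set `A`, in which two vertices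
are adjacent iff their difference lies in `D`, is strongly regular. -/
structure IsStronglyRegularCayley {A : Type*} [AddGroup A] [Fintype A] (D : Set A)
    (v k l μ : ℤ) : Prop where
  zero_notMem : (0 : A) ∉ D
  neg_eq : -D = D
  isStronglyRegular : IsStronglyRegular (SimpleGraph.addCayley D) v k l μ

/-- The multiplicative group `F ^ *` of a subfield, as a subgroup of `M ^ *`. -/
def subfieldUnits (F M : Type*) [Field F] [Field M] [Algebra F M] : Subgroup Mˣ :=
  (Units.map (algebraMap F M : F →* M)).range

/-- The Singer difference set `H₀` in `M ^ * / F ^ *`: the classes of the elements of trace `0`. -/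
def singerSet (F M : Type*) [Field F] [Field M] [Algebra F M] : Set (Mˣ ⧸ subfieldUnits F M) :=
  {z | ∃ x : Mˣ, (x : Mˣ ⧸ subfieldUnits F M) = z ∧ Algebra.trace F M (x : M) = 0}

/-- The image `C / F ^ *` of a subgroup `C` of `M ^ *` (used for `F ^ * ≤ C`) in the quotient
`M ^ * / F ^ *`. -/
def quotientImage (F : Type*) {M : Type*} [Field F] [Field M] [Algebra F M] (C : Subgroup Mˣ) :
    Set (Mˣ ⧸ subfieldUnits F M) :=
  (fun x : Mˣ => (x : Mˣ ⧸ subfieldUnits F M)) '' (C : Set Mˣ)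

/-- The number `|H₀ ∩ s C̄|`, where `C̄ = C / F ^ *`. -/
noncomputable def singerIntersection (F : Type*) {M : Type*} [Field F] [Field M] [Algebra F M]
    (C : Subgroup Mˣ) (s : Mˣ ⧸ subfieldUnits F M) : ℕ :=
  (singerSet F M ∩ s • quotientImage F C).ncard

/-- The subdifference set of `H₀` belonging to `C`, as a union of cosets of `C̄` in
`M ^ * / F ^ *`: those cosets `s C̄` for which `|H₀ ∩ s C̄|` is as large as possible. When
`|H₀ ∩ s C̄|` takes two values, they are the cosets with the larger of the two. -/
def subdifferenceSet (F : Type*) {M : Type*} [Field F] [Field M] [Algebra F M]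
    (C : Subgroup Mˣ) : Set (Mˣ ⧸ subfieldUnits F M) :=
  {s | ∀ t : Mˣ ⧸ subfieldUnits F M, singerIntersection F C t ≤ singerIntersection F C s}

/-- The cyclotomic class `γ ^ i ⟨γ ^ e⟩` as a subset of the field `K`. -/
def cyclotomicClass {K : Type*} [Field K] (γ : Kˣ) (e i : ℕ) : Set K :=
  {x | ∃ u ∈ Subgroup.zpowers (γ ^ e), ((γ ^ i * u : Kˣ) : K) = x}

/-- The norm to `M` of a unit of `K`. -/
noncomputable def unitsNorm (M : Type*) {K : Type*} [Field M] [Field K] [Algebra M K] (γ : Kˣ) :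
    Mˣ :=
  Units.map (Algebra.norm M : K →* M) γ

/-- The set `I` of exponents `0 ≤ i ≤ e - 1`, `e = [M ^ * : C]`, for which the class of `ω ^ i`
lies in the subdifference set, where `ω = Norm γ`. -/
def liftIndexSet (F M : Type*) {K : Type*} [Field F] [Field M] [Field K] [Algebra F M]
    [Algebra M K] (C : Subgroup Mˣ) (γ : Kˣ) : Set ℕ :=
  {i | i < C.index ∧
    ((unitsNorm M γ ^ i : Mˣ) : Mˣ ⧸ subfieldUnits F M) ∈ subdifferenceSet F C}

/-- The lift to `K` of the connection set `C ⊆ M`: the union of the cyclotomic classes of order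
`e = [M ^ * : C]` of `K` with index in `I`. -/
def liftedConnectionSet (F M : Type*) {K : Type*} [Field F] [Field M] [Field K] [Algebra F M]
    [Algebra M K] (C : Subgroup Mˣ) (γ : Kˣ) : Set K :=
  ⋃ i ∈ liftIndexSet F M C γ, cyclotomicClass γ C.index i

open Finset in
/-- A Cayley graph is strongly regular as soon as the number of representations of a nonzero
element as a sum of two elements of the connection set `D` depends only on membership in `D`. -/
theorem isStronglyRegularCayley_of_card {A : Type*} [AddCommGroup A] [Fintype A] [DecidableEq A]
    (D : Finset A) (k l μ : ℕ) (h0 : (0 : A) ∉ D) (hneg : ∀ x ∈ D, -x ∈ D) (hne : D.Nonempty)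
    (hnt : ∃ z, z ≠ 0 ∧ z ∉ D) (hk : #D = k)
    (hl : ∀ z ∈ D, #{x ∈ D | z - x ∈ D} = l)
    (hμ : ∀ z, z ≠ 0 → z ∉ D → #{x ∈ D | z - x ∈ D} = μ) :
    IsStronglyRegularCayley (D : Set A) (Fintype.card A) k l μ := by
  have hadj : ∀ u v, (SimpleGraph.addCayley (D : Set A)).Adj u v ↔ v - u ∈ D := by
    intro u v
    rw [SimpleGraph.addCayley_adj']
    constructor
    · rintro ⟨-, g, hg, rfl | rfl⟩
      · simpa using hg
      · simpa using hneg g hg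
    · intro h
      refine ⟨?_, v - u, h, Or.inl (by abel)⟩
      rintro rfl
      simp [h0] at h
  have hcommon : ∀ u v, Nat.card ((SimpleGraph.addCayley (D : Set A)).commonNeighbors u v) =
      #{x ∈ D | (v - u) - x ∈ D} := by
    intro u v
    rw [← Nat.card_eq_finsetCard]
    refine Nat.card_congr ((Equiv.subRight u).subtypeEquiv fun x => ?_)
    simp only [SimpleGraph.mem_commonNeighbors, hadj, Equiv.subRight_apply, mem_filter]
    refine and_congr_right fun _ => ?_
    rw [show v - u - (x - u) = -(x - v) by abel]
    exact ⟨hneg _, fun h => by simpa using hneg _ h⟩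
  refine ⟨by simpa using h0, ?_, ?_, ?_, Fintype.card A, k, l, μ, rfl, rfl, rfl, rfl, ?_⟩
  · ext x
    simp only [Set.mem_neg, mem_coe]
    exact ⟨fun h => by simpa using hneg _ h, hneg x⟩
  · obtain ⟨x, hx⟩ := hne
    intro h
    have := (hadj 0 x).2 (by simpa using hx)
    simp [h] at this
  · obtain ⟨z, hz, hzD⟩ := hnt
    intro h
    refine hzD ?_
    have : (SimpleGraph.addCayley (D : Set A)).Adj 0 z := by
      rw [h]
      exact hz.symm
    simpa using (hadj 0 z).1 this
  · generalize SimpleGraph.addCayley (D : Set A) = G at hadj hcommon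
    classical
    refine ⟨rfl, fun v => ?_, fun v w h => ?_, fun v w hvw h => ?_⟩
    · rw [← SimpleGraph.card_neighborSet_eq_degree, ← Nat.card_eq_fintype_card, ← hk,
        ← Nat.card_eq_finsetCard]
      refine Nat.card_congr ((Equiv.subRight v).subtypeEquiv fun x => ?_)
      simp only [SimpleGraph.mem_neighborSet, hadj, Equiv.subRight_apply]
    · rw [← Nat.card_eq_fintype_card, hcommon, hl _ ((hadj v w).1 h)]
    · rw [← Nat.card_eq_fintype_card, hcommon,
        hμ _ (sub_ne_zero.2 hvw.symm) (fun hh => h ((hadj v w).2 hh))]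

open Finset in
/-- All fibres of a surjective homomorphism of finite groups have the same size. -/
@[to_additive /-- All fibres of a surjective homomorphism of finite additive groups have the same
size. -/]
theorem MonoidHom.card_fiber_of_surjective {G H : Type*} [Group G] [Fintype G] [Group H]
    [Fintype H] [DecidableEq H] (f : G →* H) (hf : Function.Surjective f) (y : H) :
    #{x | f x = y} * Fintype.card H = Fintype.card G := by
  rw [← Finset.card_univ (α := G), card_eq_sum_card_fiberwise (f := f) (s := univ) (t := univ)
    (by simp), sum_congr rfl fun z _ => MonoidHom.card_fiber_eq_of_mem_range f (hf z) (hf y)]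
  simp [mul_comm]

namespace QuadraticMap

open Finset

variable {L V : Type*} [Field L] [AddCommGroup V] [Module L V] (Q : QuadraticForm L V)

theorem map_add_smul_self (x z : V) (s : L) :
    Q (x + s • z) = Q x + s * polar Q z x + s * s * Q z := by
  rw [QuadraticMap.map_add Q, Q.map_smul, polar_smul_right, polar_comm]
  simp
  ring

theorem map_sub_eq (x z : V) : Q (z - x) = Q z + Q x - polar Q z x := by
  rw [sub_eq_add_neg, QuadraticMap.map_add Q, Q.map_neg, polar_neg_right]
  ring

variable [DecidableEq L] [Fintype V]

theorem card_polar_eq_of_ne_zero (z : V) {c : L} (hc : c ≠ 0) :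
    #{x | Q x = 0 ∧ polar Q z x = c} = #{x | Q x = 0 ∧ polar Q z x = 1} := by
  refine card_equiv (MulAction.toPerm (Units.mk0 c hc)⁻¹) fun x => ?_
  have : (Units.mk0 c hc)⁻¹ • x = c⁻¹ • x := rfl
  simp only [mem_filter, mem_univ, true_and, MulAction.toPerm_apply, this, Q.map_smul,
    polar_smul_right, smul_eq_mul, mul_eq_zero, inv_eq_zero, hc, false_or]
  rw [inv_mul_eq_one₀ hc, eq_comm (a := c)]

variable [Fintype L]

theorem card_polar_eq_zero_mul {z : V} (hz : Q.polarBilin z ≠ 0) :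
    #{x | polar Q z x = 0} * Fintype.card L = Fintype.card V :=
  AddMonoidHom.card_fiber_of_surjective (Q.polarBilin z).toAddMonoidHom
    ((Q.polarBilin z).surjective hz) 0

/-- Counting the pairs `(x, s)` with `Q (x + s • z) = s ^ 2 * Q z` in two ways. -/
theorem sum_card_eq (z : V) :
    ∑ s : L, #{x | Q x = s * s * Q z} + #{x | polar Q z x = 0} =
      Fintype.card V + Fintype.card L * #{x | Q x = 0 ∧ polar Q z x = 0} := by
  have h1 : ∀ s : L, #{x | Q x = s * s * Q z} = #{x | Q x + s * polar Q z x = 0} := by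
    intro s
    refine (card_equiv (Equiv.addRight (s • z)) fun x => ?_).symm
    simp [map_add_smul_self]
  have h2 : ∀ x : V, #{s : L | Q x + s * polar Q z x = 0} + (if polar Q z x = 0 then 1 else 0) =
      1 + Fintype.card L * (if Q x = 0 ∧ polar Q z x = 0 then 1 else 0) := by
    intro x
    by_cases hp : polar Q z x = 0
    · by_cases hq : Q x = 0
      · simp [hp, hq, add_comm]
      · simp [hp, hq]
    · have : ({s : L | Q x + s * polar Q z x = 0} : Finset L) = {-Q x / polar Q z x} := by
        ext s
        simp only [mem_filter, mem_univ, true_and, mem_singleton]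
        rw [eq_div_iff hp, eq_neg_iff_add_eq_zero, add_comm]
      simp [hp, this]
  have h3 : ∑ s : L, #{x | Q x + s * polar Q z x = 0} =
      ∑ x : V, #{s : L | Q x + s * polar Q z x = 0} := by
    simp only [card_filter]
    exact sum_comm
  rw [sum_congr rfl fun s _ => h1 s, h3, card_filter, ← sum_add_distrib,
    sum_congr rfl fun x _ => h2 x, sum_add_distrib, ← mul_sum, card_filter]
  simp

theorem card_eq_card_polar (z : V) {c : L} (hc : c ≠ 0) :
    #{x | Q x = 0} = #{x | Q x = 0 ∧ polar Q z x = 0} +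
      (Fintype.card L - 1) * #{x | Q x = 0 ∧ polar Q z x = c} := by
  rw [card_eq_sum_card_fiberwise (f := fun x => polar Q z x) (t := univ) (by simp),
    ← add_sum_erase univ _ (mem_univ 0)]
  simp only [filter_filter]
  rw [sum_congr rfl fun b hb => (card_polar_eq_of_ne_zero Q z (ne_of_mem_erase hb)).trans
    (card_polar_eq_of_ne_zero Q z hc).symm]
  simp [card_erase_of_mem, Finset.card_univ]

theorem card_eq_card_zero_add {t : ℕ} (ht : ∀ c : L, c ≠ 0 → #{x | Q x = c} = t) :
    Fintype.card V = #{x | Q x = 0} + (Fintype.card L - 1) * t := by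
  rw [← Finset.card_univ, card_eq_sum_card_fiberwise (f := Q) (t := univ) (by simp),
    ← add_sum_erase univ _ (mem_univ 0), sum_congr rfl fun b hb => ht b (ne_of_mem_erase hb)]
  simp [card_erase_of_mem, Finset.card_univ]

/-- The affine polar graph of an elliptic quadratic form is strongly regular. -/
theorem isStronglyRegularCayley [DecidableEq V] {p : ℕ} (hp : 1 < p)
    (hQ : ∀ z, z ≠ 0 → Q.polarBilin z ≠ 0)
    (hV : Fintype.card V = (Fintype.card L * p) ^ 2)
    (ht : ∀ c : L, c ≠ 0 → #{x | Q x = c} = p * (Fintype.card L * p + 1)) :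
    IsStronglyRegularCayley {x | x ≠ 0 ∧ Q x = 0} (((Fintype.card L * p : ℕ) : ℤ) ^ 2)
      (((p : ℤ) - 1) * ((Fintype.card L * p : ℕ) + 1))
      (-((Fintype.card L * p : ℕ) : ℤ) + ((p : ℤ) - 1) ^ 2 + 3 * ((p : ℤ) - 1))
      (((p : ℤ) - 1) ^ 2 + ((p : ℤ) - 1)) := by
  have hq : 1 < Fintype.card L := Fintype.one_lt_card
  have hq' : ((Fintype.card L - 1 : ℕ) : ℤ) = (Fintype.card L : ℤ) - 1 := by
    push_cast [hq.le]; rfl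
  have hq0 : (Fintype.card L : ℤ) ≠ 0 := by positivity
  have hq1 : (Fintype.card L : ℤ) - 1 ≠ 0 := by omega
  have hT : (#{x | Q x = 0} : ℤ) = 1 + (p - 1) * (Fintype.card L * p + 1) := by
    have := congrArg (Nat.cast (R := ℤ)) (card_eq_card_zero_add Q ht)
    push_cast [hV, hq'] at this
    linear_combination -this
  have hP : ∀ z, z ≠ 0 → (#{x | polar Q z x = 0} : ℤ) = Fintype.card L * p ^ 2 := by
    intro z hz
    have := congrArg (Nat.cast (R := ℤ)) (card_polar_eq_zero_mul Q (hQ z hz))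
    push_cast [hV] at this
    exact mul_right_cancel₀ hq0 (by linear_combination this)
  have hW0 : ∀ z, z ≠ 0 → Q z = 0 → (#{x | Q x = 0 ∧ polar Q z x = 0} : ℤ) =
      p ^ 2 + p - Fintype.card L * p := by
    intro z hz hQz
    have := congrArg (Nat.cast (R := ℤ)) (sum_card_eq Q z)
    simp only [hQz, mul_zero, sum_const, Finset.card_univ, smul_eq_mul] at this
    push_cast [hV, hT, hP z hz] at this
    exact mul_left_cancel₀ hq0 (by linear_combination -this)
  have hW1 : ∀ z, z ≠ 0 → Q z ≠ 0 → (#{x | Q x = 0 ∧ polar Q z x = 0} : ℤ) = p ^ 2 := by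
    intro z hz hQz
    have := congrArg (Nat.cast (R := ℤ)) (sum_card_eq Q z)
    rw [← add_sum_erase univ _ (mem_univ 0), sum_congr rfl fun s hs => ht (s * s * Q z)
      (by simpa [hQz] using ne_of_mem_erase hs)] at this
    simp only [mul_zero, zero_mul, sum_const, card_erase_of_mem (mem_univ _), Finset.card_univ,
      smul_eq_mul] at this
    push_cast [hV, hT, hP z hz, hq'] at this
    exact mul_left_cancel₀ hq0 (by linear_combination -this)
  have hWc : ∀ z, z ≠ 0 → Q z ≠ 0 → (#{x | Q x = 0 ∧ polar Q z x = Q z} : ℤ) =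
      p ^ 2 - p := by
    intro z hz hQz
    have := congrArg (Nat.cast (R := ℤ)) (card_eq_card_polar Q z hQz)
    push_cast [hq', hT, hW1 z hz hQz] at this
    exact mul_left_cancel₀ hq1 (by linear_combination -this)
  set D : Finset V := {x | x ≠ 0 ∧ Q x = 0} with hD
  have hDe : D = ({x | Q x = 0} : Finset V).erase 0 := by
    ext x; simp [hD]
  have hDcard : (#D : ℤ) = (p - 1) * (Fintype.card L * p + 1) := by
    rw [hDe, cast_card_erase_of_mem (by simp), hT]
    ring
  have hnbr0 : ∀ z ∈ D, (#{x ∈ D | z - x ∈ D} : ℤ) = p ^ 2 + p - Fintype.card L * p - 2 := by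
    intro z hz
    simp only [hD, mem_filter, mem_univ, true_and] at hz
    have : ({x ∈ D | z - x ∈ D} : Finset V) =
        (({x | Q x = 0 ∧ polar Q z x = 0} : Finset V).erase 0).erase z := by
      ext x
      simp only [hD, mem_filter, mem_univ, true_and, mem_erase, map_sub_eq, hz.2, sub_ne_zero]
      constructor
      · rintro ⟨⟨h1, h2⟩, h3, h4⟩
        exact ⟨h3.symm, h1, h2, by simpa [h2] using h4⟩
      · rintro ⟨h1, h2, h3, h4⟩
        exact ⟨⟨h2, h3⟩, Ne.symm h1, by simp [h3, h4]⟩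
    rw [this, cast_card_erase_of_mem, cast_card_erase_of_mem, hW0 z hz.1 hz.2]
    · ring
    · simp
    · simp [hz.1, hz.2]
  have hnbr1 : ∀ z, z ≠ 0 → z ∉ D → (#{x ∈ D | z - x ∈ D} : ℤ) = p ^ 2 - p := by
    intro z hz hzD
    have hQz : Q z ≠ 0 := by simpa [hD, hz] using hzD
    rw [← hWc z hz hQz]
    congr 2
    ext x
    simp only [hD, mem_filter, mem_univ, true_and, map_sub_eq, sub_ne_zero]
    constructor
    · rintro ⟨⟨h1, h2⟩, h3, h4⟩
      exact ⟨h2, by rw [h2] at h4; linear_combination -h4⟩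
    · rintro ⟨h1, h2⟩
      refine ⟨⟨?_, h1⟩, ?_, by rw [h1, h2]; ring⟩
      · rintro rfl
        simp at h2
        exact hQz h2.symm
      · rintro rfl
        exact hQz h1
  have hne : D.Nonempty := by
    rw [← card_pos]
    have : (0 : ℤ) < #D := by
      rw [hDcard]
      have : (0 : ℤ) < p - 1 := by omega
      positivity
    exact_mod_cast this
  have hnt : ∃ z, z ≠ 0 ∧ z ∉ D := by
    have : 0 < #{x | Q x = 1} := by
      rw [ht 1 one_ne_zero]
      positivity
    obtain ⟨z, hz⟩ := card_pos.1 this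
    have hz : Q z = 1 := by simpa using hz
    refine ⟨z, ?_, by simp [hD, hz]⟩
    rintro rfl
    simp at hz
  obtain ⟨y, hy⟩ := hne
  obtain ⟨w, hw, hwD⟩ := hnt
  have key := isStronglyRegularCayley_of_card D (#D) (#{x ∈ D | y - x ∈ D})
    (#{x ∈ D | w - x ∈ D}) (by simp [hD]) (fun x hx => by simpa [hD] using hx) ⟨y, hy⟩
    ⟨w, hw, hwD⟩ rfl (fun z hz => by exact_mod_cast (hnbr0 z hz).trans (hnbr0 y hy).symm)
    (fun z hz hzD => by exact_mod_cast (hnbr1 z hz hzD).trans (hnbr1 w hw hwD).symm)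
  rw [hDcard, hnbr0 y hy, hnbr1 w hw hwD] at key
  convert key using 1
  · ext x; simp [hD]
  · rw [hV]; push_cast; ring
  · push_cast; ring
  · push_cast; ring
  · ring

end QuadraticMap

section NormTrace

open Finset

variable (L M K : Type*) [Field L] [Field M] [Fintype M] [Field K] [Fintype K]
  [Algebra L M] [Algebra M K]

theorem FiniteField.card_norm_eq [DecidableEq M] {y : M} (hy : y ≠ 0) :
    #{x : K | Algebra.norm M x = y} * (Fintype.card M - 1) = Fintype.card K - 1 := by
  classical
  have h := MonoidHom.card_fiber_of_surjective (Units.map (Algebra.norm M : K →* M))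
    (FiniteField.unitsMap_norm_surjective M K) (Units.mk0 y hy)
  rw [Fintype.card_units, Fintype.card_units] at h
  rw [← h]
  congr 1
  symm
  refine card_bij (fun x _ => (x : K)) (fun x hx => ?_) (fun x _ y _ h => Units.ext h)
    (fun x hx => ?_)
  · simpa [Units.ext_iff] using hx
  · simp only [mem_filter, mem_univ, true_and] at hx
    have hx0 : x ≠ 0 := by
      rintro rfl
      simp at hx
      exact hy hx.symm
    exact ⟨Units.mk0 x hx0, by simpa [Units.ext_iff] using hx, rfl⟩

theorem FiniteField.card_trace_eq [Fintype L] [DecidableEq L] (c : L) :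
    #{y : M | Algebra.trace L M y = c} * Fintype.card L = Fintype.card M :=
  AddMonoidHom.card_fiber_of_surjective (Algebra.trace L M).toAddMonoidHom
    (Algebra.trace_surjective L M) c

variable {M K} in
theorem FiniteField.norm_add_of_finrank_eq_two (hK : Module.finrank M K = 2) (x y : K) :
    Algebra.norm M (x + y) = Algebra.norm M x + Algebra.norm M y +
      Algebra.trace M K (x * y ^ Fintype.card M) := by
  apply FaithfulSMul.algebraMap_injective M K
  have hadd : (x + y) ^ Fintype.card M = x ^ Fintype.card M + y ^ Fintype.card M :=
    map_add (FiniteField.frobeniusAlgHom M K) x y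
  have hy : (y ^ Fintype.card M) ^ Fintype.card M = y := by
    rw [← pow_mul, ← sq, ← hK, ← Module.card_eq_pow_finrank, FiniteField.pow_card]
  simp only [map_add, FiniteField.algebraMap_norm_eq_prod_pow,
    FiniteField.algebraMap_trace_eq_sum_pow, hK, prod_range_succ, sum_range_succ,
    Nat.card_eq_fintype_card, range_zero, prod_empty, sum_empty, pow_zero, pow_one, hadd, mul_pow,
    hy]
  ring

variable [Algebra L K] [IsScalarTower L M K]

/-- The bilinear map `(x, y) ↦ Tr (x * σ y)` on a quadratic extension `K` of `M`, where `σ` is the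
conjugation of `K` over `M` and the trace goes down to a subfield `L` of `M`. -/
noncomputable def traceHermitian : LinearMap.BilinMap L K L :=
  LinearMap.mk₂ L (fun x y => Algebra.trace L K (x * FiniteField.frobeniusAlgHom M K y))
    (fun x x' y => by rw [add_mul, map_add])
    (fun c x y => by rw [smul_mul_assoc, map_smul])
    (fun x y y' => by rw [map_add, mul_add, map_add])
    (fun c x y => by
      rw [← algebraMap_smul M c y, map_smul, algebraMap_smul, mul_smul_comm, map_smul])

/-- The quadratic form `x ↦ Tr (N x)` over `L` on a quadratic extension `K` of `M`, where `N` is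
the norm from `K` to `M` and `Tr` the trace from `M` to `L`. -/
noncomputable def traceNormForm (hK : Module.finrank M K = 2) : QuadraticForm L K where
  toFun x := Algebra.trace L M (Algebra.norm M x)
  toFun_smul c x := by
    rw [← algebraMap_smul M c x, Algebra.smul_def, map_mul, Algebra.norm_algebraMap, hK, ← map_pow,
      ← Algebra.smul_def, map_smul, sq]
  exists_companion' := ⟨traceHermitian L M K, fun x y => by
    have := Module.Finite.of_finite (R := M) (M := K)
    rw [FiniteField.norm_add_of_finrank_eq_two hK, map_add, map_add,
      Algebra.trace_trace]
    rfl⟩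

theorem traceNormForm_apply (hK : Module.finrank M K = 2) (x : K) :
    traceNormForm L M K hK x = Algebra.trace L M (Algebra.norm M x) := rfl

theorem polarBilin_traceNormForm_ne_zero [Finite L] (hK : Module.finrank M K = 2) {z : K} (hz : z ≠ 0) :
    (traceNormForm L M K hK).polarBilin z ≠ 0 := by
  obtain ⟨w, hw⟩ := Algebra.trace_surjective L K 1
  intro h
  have h1 := LinearMap.congr_fun h ((FiniteField.frobeniusAlgEquivOfAlgebraic M K).symm (w / z))
  have h2 : Algebra.trace L K w = 0 := by
    rw [QuadraticMap.polarBilin_apply_apply, QuadraticMap.polar, traceNormForm_apply,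
      traceNormForm_apply, traceNormForm_apply, FiniteField.norm_add_of_finrank_eq_two hK, map_add,
      map_add, Algebra.trace_trace] at h1
    have h3 : ((FiniteField.frobeniusAlgEquivOfAlgebraic M K).symm (w / z)) ^ Fintype.card M =
        w / z := (FiniteField.frobeniusAlgEquivOfAlgebraic M K).apply_symm_apply (w / z)
    rw [h3, mul_div_cancel₀ _ hz] at h1
    rw [LinearMap.zero_apply] at h1
    linear_combination h1
  rw [hw] at h2
  exact one_ne_zero h2

theorem card_traceNormForm_eq [Fintype L] [DecidableEq L] (hK : Module.finrank M K = 2) {p : ℕ}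
    (hM : Fintype.card M = Fintype.card L * p) {c : L} (hc : c ≠ 0) :
    #{x | traceNormForm L M K hK x = c} = p * (Fintype.card L * p + 1) := by
  classical
  have htr : #{y : M | Algebra.trace L M y = c} = p := by
    have := FiniteField.card_trace_eq L M c
    rw [hM, mul_comm] at this
    exact Nat.eq_of_mul_eq_mul_left Fintype.card_pos this
  have hnorm : ∀ y : M, y ≠ 0 → #{x : K | Algebra.norm M x = y} = Fintype.card L * p + 1 := by
    intro y hy
    have h := FiniteField.card_norm_eq M K hy
    rw [Module.card_eq_pow_finrank (K := M) (V := K), hK] at h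
    have hM1 : 1 < Fintype.card M := Fintype.one_lt_card
    refine Nat.eq_of_mul_eq_mul_right (Nat.sub_pos_of_lt hM1) (h.trans ?_)
    rw [← hM, ← Nat.sq_sub_sq, one_pow]
  rw [card_eq_sum_card_fiberwise (f := Algebra.norm M)
    (t := ({y : M | Algebra.trace L M y = c} : Finset M))
    (fun x hx => by rwa [mem_coe, mem_filter_univ] at hx ⊢)]
  nth_rewrite 1 [← htr]
  rw [card_eq_sum_ones, sum_mul]
  refine sum_congr rfl fun y hy => ?_
  simp only [mem_filter, mem_univ, true_and] at hy
  rw [one_mul, ← hnorm y (by rintro rfl; simp at hy; exact hc hy.symm), filter_filter]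
  congr 1
  ext x
  rw [mem_filter_univ, mem_filter_univ]
  exact and_iff_right_of_imp fun h => by rw [traceNormForm_apply, h, hy]

/-- The zeros of `x ↦ Tr (N x)` in a quadratic extension `K` of `M` are the connection set of a
strongly regular Cayley graph. -/
theorem isStronglyRegularCayley_trace_norm [Fintype L] (hK : Module.finrank M K = 2) {d : ℕ} (hd : 1 < d)
    (hM : Module.finrank L M = d) {n r : ℕ} (hn : n = Fintype.card L ^ d)
    (hr : r = Fintype.card L ^ (d - 1) - 1) :
    IsStronglyRegularCayley {x : K | x ≠ 0 ∧ Algebra.trace L M (Algebra.norm M x) = 0}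
      ((n : ℤ) ^ 2) ((r : ℤ) * (n + 1)) (-(n : ℤ) + (r : ℤ) ^ 2 + 3 * r) ((r : ℤ) ^ 2 + r) := by
  classical
  have hL : 1 < Fintype.card L := Fintype.one_lt_card
  have hp : 1 < Fintype.card L ^ (d - 1) := Nat.one_lt_pow (by omega) hL
  have hn' : n = Fintype.card L * Fintype.card L ^ (d - 1) := by
    rw [hn, ← pow_succ', Nat.sub_add_cancel hd.le]
  have hcM : Fintype.card M = Fintype.card L * Fintype.card L ^ (d - 1) := by
    rw [Module.card_eq_pow_finrank (K := L) (V := M), hM, ← hn, hn']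
  have hr' : (r : ℤ) = ((Fintype.card L ^ (d - 1) : ℕ) : ℤ) - 1 := by
    rw [hr, Nat.cast_sub hp.le, Nat.cast_one]
  rw [hr', hn']
  exact QuadraticMap.isStronglyRegularCayley (traceNormForm L M K hK) hp
    (fun z hz => polarBilin_traceNormForm_ne_zero L M K hK hz)
    (by rw [Module.card_eq_pow_finrank (K := M) (V := K), hK, hcM])
    (fun c hc => card_traceNormForm_eq L M K hK hcM hc)

end NormTrace

section Subdifference

variable {F M : Type*} [Field F] [Field M] [Algebra F M]

theorem mk_mem_singerSet {x : Mˣ} :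
    (x : Mˣ ⧸ subfieldUnits F M) ∈ singerSet F M ↔ Algebra.trace F M (x : M) = 0 := by
  refine ⟨?_, fun h => ⟨x, rfl, h⟩⟩
  rintro ⟨y, hy, h0⟩
  obtain ⟨u, hu⟩ := QuotientGroup.eq.1 hy
  have hx : (x : M) = (u : F) • (y : M) := by
    rw [Algebra.smul_def, mul_comm]
    have := congrArg (fun v : Mˣ => ((y * v : Mˣ) : M)) hu
    simpa using this.symm
  rw [hx, map_smul, h0, smul_zero]

theorem mem_smul_quotientImage {C : Subgroup Mˣ} {s : Mˣ} {z : Mˣ ⧸ subfieldUnits F M} :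
    z ∈ (s : Mˣ ⧸ subfieldUnits F M) • quotientImage F C ↔
      ∃ c ∈ C, ((s * c : Mˣ) : Mˣ ⧸ subfieldUnits F M) = z := by
  simp [Set.mem_smul_set, quotientImage]

variable [Finite M] (L : IntermediateField F M)

theorem smul_quotientImage_subset_singerSet_iff (s : Mˣ) :
    (s : Mˣ ⧸ subfieldUnits F M) • quotientImage F (subfieldUnits L M) ⊆ singerSet F M ↔
      Algebra.trace L M (s : M) = 0 := by
  have := Module.Finite.of_finite (R := F) (M := M)
  have := Finite.of_injective _ (FaithfulSMul.algebraMap_injective F M)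
  have htr : ∀ u : Lˣ, Algebra.trace F M ((s : M) * algebraMap L M u) =
      Algebra.trace F L ((u : L) * Algebra.trace L M (s : M)) := by
    intro u
    rw [mul_comm, ← Algebra.smul_def, ← Algebra.trace_trace (S := L), map_smul, smul_eq_mul]
  constructor
  · intro h
    by_contra h0
    obtain ⟨w, hw⟩ := Algebra.trace_surjective F L 1
    have hw0 : w ≠ 0 := by
      rintro rfl
      simp at hw
    have := mk_mem_singerSet.1 (h (mem_smul_quotientImage.2
      ⟨_, ⟨Units.mk0 (w / Algebra.trace L M (s : M)) (div_ne_zero hw0 h0), rfl⟩, rfl⟩))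
    rw [Units.val_mul] at this
    have h1 := (htr _).symm.trans this
    rw [Units.val_mk0, div_mul_cancel₀ _ h0, hw] at h1
    exact one_ne_zero h1
  · rintro h z hz
    obtain ⟨_, ⟨u, rfl⟩, rfl⟩ := mem_smul_quotientImage.1 hz
    refine mk_mem_singerSet.2 ((htr u).trans ?_)
    rw [h, mul_zero, map_zero]

/-- The coset of `s` lies in the subdifference set belonging to a proper subfield `L` exactly when
the trace of `s` to `L` vanishes. -/
theorem mk_mem_subdifferenceSet_iff (hL : 1 < Module.finrank L M) (s : Mˣ) :
    (s : Mˣ ⧸ subfieldUnits F M) ∈ subdifferenceSet F (subfieldUnits L M) ↔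
      Algebra.trace L M (s : M) = 0 := by
  set C : Set (Mˣ ⧸ subfieldUnits F M) := quotientImage F (subfieldUnits L M) with hC
  have hle : ∀ t : Mˣ ⧸ subfieldUnits F M,
      singerIntersection F (subfieldUnits L M) t ≤ C.ncard := fun t => by
    rw [← Set.ncard_smul_set t C]
    exact Set.ncard_le_ncard Set.inter_subset_right (Set.toFinite _)
  have heq : ∀ t : Mˣ, singerIntersection F (subfieldUnits L M) (t : Mˣ ⧸ subfieldUnits F M) =
      C.ncard ↔ Algebra.trace L M (t : M) = 0 := by
    intro t
    rw [← smul_quotientImage_subset_singerSet_iff, ← Set.inter_eq_right,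
      ← Set.ncard_smul_set (t : Mˣ ⧸ subfieldUnits F M) C]
    refine ⟨fun h => Set.eq_of_subset_of_ncard_le Set.inter_subset_right h.ge (Set.toFinite _),
      fun h => congrArg Set.ncard h⟩
  obtain ⟨t, ht⟩ : ∃ t : Mˣ, Algebra.trace L M (t : M) = 0 := by
    have := Module.Finite.of_finite (R := L) (M := M)
    have hker : (Algebra.trace L M).ker ≠ ⊥ := LinearMap.ker_ne_bot_of_finrank_lt (by simpa using hL)
    obtain ⟨t, ht, ht0⟩ := Submodule.exists_mem_ne_zero_of_ne_bot hker
    exact ⟨Units.mk0 t ht0, ht⟩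
  rw [← heq]
  refine ⟨fun h => (hle _).antisymm ?_, fun h t => (hle t).trans h.ge⟩
  exact ((heq t).2 ht).ge.trans (h t)

theorem mem_liftedConnectionSet_iff {K : Type*} [Field K] [Algebra M K]
    (hL : 1 < Module.finrank L M) (γ : Kˣ) (hγ : ∀ x : Kˣ, x ∈ Subgroup.zpowers γ) (x : K) :
    x ∈ liftedConnectionSet F M (subfieldUnits L M) γ ↔
      x ≠ 0 ∧ Algebra.trace L M (Algebra.norm M x) = 0 := by
  set C := subfieldUnits L M with hC
  have he : 0 < C.index := Nat.pos_of_ne_zero C.index_ne_zero_of_finite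
  have hpow : ∀ u ∈ Subgroup.zpowers (γ ^ C.index), unitsNorm M u ∈ C := by
    rintro _ ⟨k, rfl⟩
    have : unitsNorm M ((γ ^ C.index) ^ k) = (unitsNorm M γ ^ C.index) ^ k := by
      simp [unitsNorm]
    exact this ▸ C.zpow_mem (C.pow_index_mem _) k
  have key : ∀ i : ℕ, ∀ u ∈ Subgroup.zpowers (γ ^ C.index),
      (Algebra.trace L M (Algebra.norm M ((γ ^ i * u : Kˣ) : K)) = 0 ↔
        Algebra.trace L M ((unitsNorm M γ ^ i : Mˣ) : M) = 0) := by
    intro i u hu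
    obtain ⟨l, hl⟩ := hpow u hu
    have h1 : Algebra.norm M ((γ ^ i * u : Kˣ) : K) =
        (l : L) • ((unitsNorm M γ ^ i : Mˣ) : M) := by
      have h2 : Algebra.norm M (u : K) = algebraMap L M l := (congrArg Units.val hl).symm
      rw [Units.val_mul, map_mul, h2, Algebra.smul_def, mul_comm]
      congr 1
      simp [unitsNorm]
    rw [h1, map_smul, smul_eq_zero, or_iff_right l.ne_zero]
  simp only [liftedConnectionSet, liftIndexSet, cyclotomicClass, Set.mem_iUnion, Set.mem_ofPred_eq,
    exists_prop]
  constructor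
  · rintro ⟨i, ⟨-, hi⟩, u, hu, rfl⟩
    exact ⟨Units.ne_zero _, (key i u hu).2 ((mk_mem_subdifferenceSet_iff L hL _).1 hi)⟩
  · rintro ⟨hx, h⟩
    obtain ⟨j, hj⟩ := hγ (Units.mk0 x hx)
    have hj : γ ^ j = Units.mk0 x hx := hj
    have he' : (0 : ℤ) < C.index := by exact_mod_cast he
    obtain ⟨i, hi⟩ := Int.eq_ofNat_of_zero_le (Int.emod_nonneg j he'.ne')
    have hu : (γ ^ C.index) ^ (j / C.index) ∈ Subgroup.zpowers (γ ^ C.index) := ⟨_, rfl⟩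
    have hdec : γ ^ i * (γ ^ C.index) ^ (j / C.index) = Units.mk0 x hx := by
      rw [← hj, ← zpow_natCast, ← zpow_natCast, ← zpow_mul, ← zpow_add, ← hi,
        Int.emod_add_mul_ediv]
    have hval : ((γ ^ i * (γ ^ C.index) ^ (j / C.index) : Kˣ) : K) = x := by
      rw [hdec, Units.val_mk0]
    refine ⟨i, ⟨?_, (mk_mem_subdifferenceSet_iff L hL _).2 ((key i _ hu).1 (by rw [hval]; exact h))⟩,
      _, hu, hval⟩
    have := Int.emod_lt_of_pos j he'
    rw [hi] at this
    exact_mod_cast this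

end Subdifference

theorem exists_isStronglyRegularCayley {q m a n r : ℕ} (hq : IsPrimePow q) (hm : m ≠ 0)
    (ham : a ∣ m) (ha : a < m) (hn : n = q ^ m) (hr : r = q ^ (m - a) - 1) :
    ∃ (A : Type) (_ : AddCommGroup A) (_ : Fintype A) (D : Set A),
      IsStronglyRegularCayley D ((n : ℤ) ^ 2) ((r : ℤ) * (n + 1))
        (-(n : ℤ) + (r : ℤ) ^ 2 + 3 * r) ((r : ℤ) ^ 2 + r) := by
  obtain ⟨p, k, hp, hk, rfl⟩ := (isPrimePow_nat_iff _).1 hq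
  have : Fact p.Prime := ⟨hp⟩
  obtain ⟨d, rfl⟩ := ham
  have ha0 : a ≠ 0 := left_ne_zero_of_mul hm
  have : NeZero d := ⟨right_ne_zero_of_mul hm⟩
  have hd : 1 < d := by
    by_contra h
    exact absurd (Nat.mul_le_mul_left a (not_lt.1 h)) (by omega)
  let L := GaloisField p (k * a)
  let M := FiniteField.Extension L p d
  have : CharP M p := charP_of_injective_algebraMap (FaithfulSMul.algebraMap_injective L M) p
  let K := FiniteField.Extension M p 2
  let : Fintype L := Fintype.ofFinite L
  let : Fintype M := Fintype.ofFinite M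
  let : Fintype K := Fintype.ofFinite K
  let : Algebra L K := ((algebraMap M K).comp (algebraMap L M)).toAlgebra
  have : IsScalarTower L M K := .of_algebraMap_eq fun _ => rfl
  have hL : Fintype.card L = (p ^ k) ^ a := by
    rw [← Nat.card_eq_fintype_card, GaloisField.card p _ (mul_ne_zero hk.ne' ha0), pow_mul]
  refine ⟨K, inferInstance, inferInstance, _, isStronglyRegularCayley_trace_norm L M K
    (FiniteField.finrank_extension M p 2) hd (FiniteField.finrank_extension L p d) ?_ ?_⟩
  · rw [hn, hL, pow_mul]
  · rw [hr, hL, ← pow_mul (p ^ k), Nat.mul_sub_one]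

theorem corollary3p3 (q m a n r : ℕ) (hq : IsPrimePow q) (hm : 3 ≤ m) (ham : a ∣ m) (ha : a < m)
    (hn : n = q ^ m) (hr : r = q ^ (m - a) - 1) :
    (∃ (A : Type) (_ : AddCommGroup A) (_ : Fintype A) (D : Set A),
      IsStronglyRegularCayley D ((n : ℤ) ^ 2) ((r : ℤ) * (n + 1))
        (-(n : ℤ) + (r : ℤ) ^ 2 + 3 * r) ((r : ℤ) ^ 2 + r)) ∧
    (∀ (F : Type*) (M : Type*) (K : Type*) [Field F] [Fintype F] [Field M] [Field K] [Fintype K]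
      [Algebra F M] [Algebra M K] (L : IntermediateField F M) (γ : Kˣ),
      Fintype.card F = q → Module.finrank F M = m → Module.finrank M K = 2 →
      Module.finrank F L = a → (∀ x : Kˣ, x ∈ Subgroup.zpowers γ) →
      IsStronglyRegularCayley (liftedConnectionSet F M (subfieldUnits L M) γ)
        ((n : ℤ) ^ 2) ((r : ℤ) * (n + 1))
        (-(n : ℤ) + (r : ℤ) ^ 2 + 3 * r) ((r : ℤ) ^ 2 + r)) := by
  refine ⟨exists_isStronglyRegularCayley hq (by omega) ham ha hn hr, ?_⟩
  intro F M K _ _ _ _ _ _ _ L γ hF hM hK hL hγ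
  have : Finite M := Finite.of_injective _ (FaithfulSMul.algebraMap_injective M K)
  let : Fintype M := Fintype.ofFinite M
  let : Fintype L := Fintype.ofFinite L
  have : FiniteDimensional F M := Module.Finite.of_finite
  obtain ⟨d, rfl⟩ := ham
  have hLM : Module.finrank L M = d := by
    have := Module.finrank_mul_finrank F L M
    rw [hL, hM] at this
    exact Nat.eq_of_mul_eq_mul_left (Nat.pos_of_ne_zero (by rintro rfl; omega)) this
  have hd : 1 < d := by
    by_contra h
    exact absurd (Nat.mul_le_mul_left a (not_lt.1 h)) (by omega)
  have hcL : Fintype.card L = q ^ a := by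
    rw [Module.card_eq_pow_finrank (K := F) (V := L), hF, hL]
  have hset : liftedConnectionSet F M (subfieldUnits L M) γ =
      {x : K | x ≠ 0 ∧ Algebra.trace L M (Algebra.norm M x) = 0} :=
    Set.ext fun x => mem_liftedConnectionSet_iff L (hLM ▸ hd) γ hγ x
  rw [hset]
  refine isStronglyRegularCayley_trace_norm L M K hK hd hLM ?_ ?_
  · rw [hn, hcL, ← pow_mul]
  · rw [hr, hcL, ← pow_mul, Nat.mul_sub_one]
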